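/- A $k$-graph is a pair $(X,\mathscr{M})$ where $X$ is a finite set and $\mathscr{M}$ is a set of $k$-element subsets of $X$. An automorphism of $(X,\mathscr{M})$ is a bijection $\phi:X\to X$ such that, for every $A\subseteq X$, $A\in\mathscr{M}$ if and only if $\phi(A)\in\mathscr{M}$. A $k$-graph is asymmetric if the identity is its only automorphism, and symmetric otherwise. The subhypergraph induced on $S\subseteq X$ is $(S,\{M\in\mathscr{M} : M\subseteq S\})$. A $k$-graph $(X,\mathscr{M})$ is minimal asymmetric if it is asymmetric and, for every $S\subseteq X$ with $1<|S|<|X|$, the subhypergraph induced on $S$ is symmetric. Theorem. For every integer $k\ge 3$, there exist infinitely many pairwise non-isomorphic minimal asymmetric $k$-graphs. -/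

import Mathlib

open scoped Hypergraph

namespace Hypergraph

variable {α β : Type*}

/-- A `k`-graph (`k`-uniform hypergraph) is a finite hypergraph all of whose edges have exactly
`k` elements. -/
def IsKGraph (k : ℕ) (G : Hypergraph α) : Prop :=
  V(G).Finite ∧ ∀ e ∈ E(G), e.encard = k

/-- A bijection between vertex sets is an isomorphism if a set of vertices is an edge exactly when
its image is an edge. -/
def IsIsomorphism (G : Hypergraph α) (H : Hypergraph β) (φ : V(G) ≃ V(H)) : Prop :=
  ∀ e : Set V(G), Subtype.val '' e ∈ E(G) ↔ Subtype.val '' (φ '' e) ∈ E(H)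

/-- Two hypergraphs are isomorphic. -/
def Isomorphic (G : Hypergraph α) (H : Hypergraph β) : Prop :=
  ∃ φ : V(G) ≃ V(H), IsIsomorphism G H φ

/-- A hypergraph is asymmetric if its only automorphism is the identity. -/
def IsAsymmetric (G : Hypergraph α) : Prop :=
  ∀ φ : V(G) ≃ V(G), IsIsomorphism G G φ → φ = Equiv.refl V(G)

/-- A hypergraph is symmetric if it is not asymmetric. -/
def IsSymmetric (G : Hypergraph α) : Prop := ¬ IsAsymmetric G

/-- The subhypergraph of `G` induced on a set `S` of vertices: its edges are the edges of `G`
contained in `S`. -/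
def induce (G : Hypergraph α) (S : Set α) : Hypergraph α where
  vertexSet := V(G) ∩ S
  edgeSet := {e | e ∈ E(G) ∧ e ⊆ S}
  subset_vertexSet_of_mem_edgeSet' := fun _ he =>
    Set.subset_inter (G.subset_vertexSet_of_mem_edgeSet' he.1) he.2

/-- A hypergraph is minimal asymmetric if it is asymmetric and each of its induced subhypergraphs
with more than one vertex, but fewer vertices than the whole, is symmetric. -/
def IsMinimalAsymmetric (G : Hypergraph α) : Prop :=
  IsAsymmetric G ∧
    ∀ S : Set α, S ⊆ V(G) → 1 < S.encard → S.encard < V(G).encard → IsSymmetric (G.induce S)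

end Hypergraph

/-!
The theorem follows from one family of `3`-graphs and one operation that raises `k`.

**The case `k = 3`.** `theta c` is a loose path with edges `{2i, 2i+1, 2i+2}`, `i ≤ 2c`, closed up
by the chord `{0, 2c, 4c+2}`. The odd vertices are those lying on a single edge, so the chord is the
only edge without such a vertex and every automorphism preserves it, and hence the path as well.
The path can only be fixed or reversed, and reversing it moves the vertex `2c` of the chord, the
midpoint of the path being `2c+1` (`isAsymmetric_theta`). A proper set `S` of at least two vertices
either misses the chord or breaks the path. If a run of path edges in `S` ends at a vertex on no
other edge in `S`, the last two vertices of the run are twins and can be exchanged. Otherwise the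
edges in `S` are the chord alone, with twins, or the chord together with one of the two segments
into which `2c` cuts the path; these form a single loose cycle, which has a reflection
(`isSymmetric_induce_theta`).

**From `k` to `k + 1`.** `coCone` adds an apex to all `k`-sets of vertices that are not edges.
Passing to the `k`-uniform complement does not change automorphisms of induced subhypergraphs, and
adding an apex only adds symmetries if some other vertex also lies on every edge of the cone.
`HasAvoidingNonedges` rules that out. Thanks to the complementation, this condition holds again
for the new hypergraph as soon as there are `k + 2` vertices, so that the step can be iterated.

The hypergraphs obtained for different `c` have different numbers of vertices.
-/

namespace Hypergraph

variable {α β : Type*}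

/-! ### Automorphisms as permutations of the ambient type -/

theorem Isomorphic.encard_eq {G : Hypergraph α} {H : Hypergraph β} (h : G.Isomorphic H) :
    V(G).encard = V(H).encard :=
  let ⟨φ, _⟩ := h
  Set.encard_congr φ

theorem perm_apply_mem_iff {σ : Equiv.Perm α} {S : Set α} (h : ∀ x ∉ S, σ x = x) (x : α) :
    σ x ∈ S ↔ x ∈ S := by
  constructor
  · intro hx
    by_contra hx'
    exact hx' (h x hx' ▸ hx)
  · intro hx
    by_contra hx'
    have := σ.injective (h _ hx')
    exact hx' (this.symm ▸ hx)

theorem perm_image_subset_iff {σ : Equiv.Perm α} {S : Set α} (h : ∀ x ∉ S, σ x = x) (e : Set α) :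
    σ '' e ⊆ S ↔ e ⊆ S := by
  rw [Set.image_subset_iff]
  exact forall_congr' fun x => imp_congr_right fun _ => perm_apply_mem_iff h x

/-- Automorphisms can be taken to be permutations of the ambient type that fix every non-vertex. -/
theorem isAsymmetric_iff {G : Hypergraph α} :
    G.IsAsymmetric ↔ ∀ σ : Equiv.Perm α, (∀ x ∉ V(G), σ x = x) →
      (∀ e, e ∈ E(G) ↔ σ '' e ∈ E(G)) → σ = 1 := by
  classical
  constructor
  · intro h σ hfix hσ
    have key := h (σ.subtypePerm (perm_apply_mem_iff hfix)) (by
      intro e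
      rw [hσ, Set.image_image, Set.image_image]
      rfl)
    ext x
    by_cases hx : x ∈ V(G)
    · exact congrArg Subtype.val (DFunLike.congr_fun key ⟨x, hx⟩)
    · exact hfix x hx
  · intro h φ hφ
    have hval : ∀ x : V(G), Equiv.Perm.ofSubtype φ (x : α) = φ x := fun x =>
      Equiv.Perm.ofSubtype_apply_coe φ x
    have hfix : ∀ x ∉ V(G), Equiv.Perm.ofSubtype φ x = x := fun x hx =>
      Equiv.Perm.ofSubtype_apply_of_not_mem φ hx
    have himage : ∀ e : Set V(G),
        Equiv.Perm.ofSubtype φ '' (Subtype.val '' e) = Subtype.val '' (φ '' e) := by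
      intro e
      rw [Set.image_image, Set.image_image]
      exact Set.image_congr fun x _ => hval x
    have key := h (Equiv.Perm.ofSubtype φ) hfix (by
      intro e
      by_cases he : e ⊆ V(G)
      · have : e = Subtype.val '' (Subtype.val ⁻¹' e : Set V(G)) := by
          rw [Subtype.image_preimage_coe, Set.inter_eq_self_of_subset_right he]
        rw [this, himage]
        exact hφ _
      · obtain ⟨x, hxe, hxV⟩ := Set.not_subset.1 he
        refine iff_of_false (fun h' => he (G.subset_vertexSet_of_mem_edgeSet h')) fun h' => hxV ?_
        exact G.subset_vertexSet_of_mem_edgeSet h' ⟨x, hxe, hfix x hxV⟩)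
    ext x
    rw [← hval, key]
    rfl

theorem isSymmetric_induce_iff {G : Hypergraph α} {S : Set α} (hS : S ⊆ V(G)) :
    (G.induce S).IsSymmetric ↔ ∃ σ : Equiv.Perm α, σ ≠ 1 ∧ (∀ x ∉ S, σ x = x) ∧
      ∀ e ⊆ S, e ∈ E(G) ↔ σ '' e ∈ E(G) := by
  have hV : V(G.induce S) = S := Set.inter_eq_self_of_subset_right hS
  have hE : ∀ e, e ∈ E(G.induce S) ↔ e ∈ E(G) ∧ e ⊆ S := fun e => Iff.rfl
  rw [IsSymmetric, isAsymmetric_iff, hV]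
  push Not
  refine exists_congr fun σ => ?_
  constructor
  · rintro ⟨h1, h2, h3⟩
    refine ⟨h3, h1, fun e he => ?_⟩
    have := h2 e
    rw [hE, hE, perm_image_subset_iff h1] at this
    tauto
  · rintro ⟨h3, h1, h2⟩
    refine ⟨h1, fun e => ?_, h3⟩
    rw [hE, hE, perm_image_subset_iff h1]
    have := h2 e
    tauto

theorem isSymmetric_induce_of_involutive {G : Hypergraph α} {S : Set α} (hS : S ⊆ V(G))
    {ρ : α → α} (hρ : Function.Involutive ρ) (hne : ∃ x, ρ x ≠ x) (hfix : ∀ x ∉ S, ρ x = x)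
    (hE : ∀ e ⊆ S, e ∈ E(G) → ρ '' e ∈ E(G)) : (G.induce S).IsSymmetric := by
  refine (isSymmetric_induce_iff hS).2 ⟨hρ.toPerm, ?_, hfix, fun e he => ⟨hE e he, fun h => ?_⟩⟩
  · rintro h
    obtain ⟨x, hx⟩ := hne
    exact hx (DFunLike.congr_fun h x)
  · have hmem : ρ '' e ⊆ S := (perm_image_subset_iff (σ := hρ.toPerm) hfix e).2 he
    have := hE _ hmem h
    rwa [Set.image_image, Set.image_congr fun x _ => hρ x, Set.image_id'] at this

/-- Twins, that is two vertices of `S` lying in the same edges of the induced subhypergraph, can be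
exchanged. -/
theorem isSymmetric_induce_of_twins {G : Hypergraph α} {S : Set α} (hS : S ⊆ V(G)) {x y : α}
    (hx : x ∈ S) (hy : y ∈ S) (hxy : x ≠ y) (h : ∀ e ∈ E(G), e ⊆ S → (x ∈ e ↔ y ∈ e)) :
    (G.induce S).IsSymmetric := by
  classical
  refine isSymmetric_induce_of_involutive hS (ρ := Equiv.swap x y)
    (fun z => Equiv.swap_apply_self x y z) ⟨x, ?_⟩ ?_ ?_
  · rw [Equiv.swap_apply_left]
    exact hxy.symm
  · intro z hz
    exact Equiv.swap_apply_of_ne_of_ne (fun h => hz (h ▸ hx)) (fun h => hz (h ▸ hy))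
  · intro e he hE
    have : Equiv.swap x y '' e = e := by
      have hiff := h e hE he
      ext z
      rw [← Equiv.symm_swap, Equiv.image_symm_eq_preimage, Set.mem_preimage]
      rcases eq_or_ne z x with rfl | hzx
      · rw [Equiv.swap_apply_left, hiff]
      rcases eq_or_ne z y with rfl | hzy
      · rw [Equiv.swap_apply_right, hiff]
      rw [Equiv.swap_apply_of_ne_of_ne hzx hzy]
    rwa [this]

/-! ### The cone over the complement -/

/-- The cone over the `k`-uniform complement of `G`: a new vertex `v` is added, and the edges are
the sets `insert v e` with `e` a `k`-element set of vertices of `G` that is not an edge of `G`. -/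
def coCone (G : Hypergraph α) (k : ℕ) (v : α) : Hypergraph α where
  vertexSet := insert v V(G)
  edgeSet := {f | ∃ e ⊆ V(G), e.encard = k ∧ e ∉ E(G) ∧ f = insert v e}
  subset_vertexSet_of_mem_edgeSet' := by
    rintro _ ⟨e, he, -, -, rfl⟩
    exact Set.insert_subset_insert he

/-- Every vertex is avoided by some `k`-element set of vertices that is not an edge. This makes the
apex of `G.coCone k v` the only vertex lying in all its edges. -/
def HasAvoidingNonedges (G : Hypergraph α) (k : ℕ) : Prop :=
  ∀ w, ∃ e ⊆ V(G), e.encard = k ∧ w ∉ e ∧ e ∉ E(G)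

theorem insert_mem_edgeSet_coCone {G : Hypergraph α} {k : ℕ} {v : α} (hv : v ∉ V(G)) {e : Set α}
    (he : v ∉ e) :
    insert v e ∈ E(G.coCone k v) ↔ e ⊆ V(G) ∧ e.encard = k ∧ e ∉ E(G) := by
  constructor
  · rintro ⟨e', he', hk, hE, h⟩
    have : e = e' := by
      rw [← Set.insert_sdiff_self_of_notMem he, h,
        Set.insert_sdiff_self_of_notMem fun h' => hv (he' h')]
    subst this
    exact ⟨he', hk, hE⟩
  · rintro ⟨h1, h2, h3⟩
    exact ⟨e, h1, h2, h3, rfl⟩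

theorem IsKGraph.coCone {G : Hypergraph α} {k : ℕ} (hG : G.IsKGraph k) {v : α} (hv : v ∉ V(G)) :
    (G.coCone k v).IsKGraph (k + 1) := by
  refine ⟨hG.1.insert v, ?_⟩
  rintro _ ⟨e, he, hk, -, rfl⟩
  rw [Set.encard_insert_of_notMem fun h => hv (he h), hk]
  rfl

theorem IsAsymmetric.coCone {G : Hypergraph α} {k : ℕ} (hG : G.IsKGraph k) (hA : G.IsAsymmetric)
    (hN : G.HasAvoidingNonedges k) {v : α} (hv : v ∉ V(G)) : (G.coCone k v).IsAsymmetric := by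
  rw [isAsymmetric_iff] at hA ⊢
  intro σ hfix hσ
  have hσv : σ v = v := by
    by_contra hne
    obtain ⟨e, he, hk, hw, hE⟩ := hN (σ v)
    have hmem : insert v e ∈ E(G.coCone k v) := ⟨e, he, hk, hE, rfl⟩
    -- The apex lies on every edge, so `σ v` does too, in contrast to the edge `insert v e`.
    have hpre : σ '' (σ.symm '' insert v e) = insert v e := σ.image_symm_image _
    rw [← hpre, ← hσ] at hmem
    obtain ⟨e', -, -, -, h⟩ := hmem
    have : v ∈ σ.symm '' insert v e := h ▸ Set.mem_insert v e'
    rw [Equiv.image_symm_eq_preimage] at this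
    exact this.elim hne hw
  have hfix' : ∀ x ∉ V(G), σ x = x := by
    intro x hx
    by_cases hxv : x = v
    · rw [hxv, hσv]
    · exact hfix x fun h => h.elim hxv hx
  refine hA σ hfix' fun e => ?_
  have hsub := perm_image_subset_iff hfix' e
  by_cases he : e ⊆ V(G)
  · have hve : v ∉ e := fun h => hv (he h)
    have hve' : v ∉ σ '' e := fun h => hv (hsub.2 he h)
    have h := hσ (insert v e)
    rw [Set.image_insert_eq, hσv, insert_mem_edgeSet_coCone hv hve,
      insert_mem_edgeSet_coCone hv hve', hsub, σ.injective.encard_image] at h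
    have := hG.2 e
    have := hG.2 (σ '' e)
    rw [σ.injective.encard_image] at this
    tauto
  · exact iff_of_false (fun h => he (G.subset_vertexSet_of_mem_edgeSet h))
      fun h => he (hsub.1 (G.subset_vertexSet_of_mem_edgeSet h))

theorem IsMinimalAsymmetric.coCone {G : Hypergraph α} {k : ℕ} (hk : 2 ≤ k) (hG : G.IsKGraph k)
    (hA : G.IsMinimalAsymmetric) (hN : G.HasAvoidingNonedges k) {v : α} (hv : v ∉ V(G)) :
    (G.coCone k v).IsMinimalAsymmetric := by
  refine ⟨hA.1.coCone hG hN hv, fun S hS h1 hlt => ?_⟩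
  obtain ⟨x, y, hx, hy, hxy⟩ := Set.one_lt_encard_iff.1 h1
  by_cases hvS : v ∈ S
  swap
  · refine isSymmetric_induce_of_twins hS hx hy hxy ?_
    rintro _ ⟨e, -, -, -, rfl⟩ hsub
    exact absurd (hsub (Set.mem_insert v e)) hvS
  have hins : insert v (S \ {v}) = S := by simp [hvS]
  have hcard : S.encard = (S \ {v}).encard + 1 := by
    conv_lhs => rw [← hins, Set.encard_insert_of_notMem (by simp)]
  have hSV : S \ {v} ⊆ V(G) := fun z hz => (hS hz.1).resolve_left hz.2
  by_cases hS1 : 1 < (S \ {v}).encard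
  · have hlt' : (S \ {v}).encard < V(G).encard := by
      change S.encard < (insert v V(G)).encard at hlt
      rw [hcard, Set.encard_insert_of_notMem hv] at hlt
      exact lt_of_add_lt_add_right hlt
    obtain ⟨σ, hne, hfix, hσ⟩ := (isSymmetric_induce_iff hSV).1 (hA.2 _ hSV hS1 hlt')
    have hσv : σ v = v := hfix v (by simp)
    refine (isSymmetric_induce_iff hS).2
      ⟨σ, hne, fun z hz => hfix z fun h => hz h.1, fun f hf => ?_⟩
    -- On edges through the apex, `σ` acts as on non-edges of `G`.
    by_cases hvf : v ∈ f
    · obtain ⟨e, hve, rfl⟩ : ∃ e, v ∉ e ∧ f = insert v e := ⟨f \ {v}, by simp, by simp [hvf]⟩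
      have he : e ⊆ S \ {v} := fun z hz =>
        ⟨hf (Set.mem_insert_of_mem v hz), fun h => hve (h ▸ hz)⟩
      have he' := (perm_image_subset_iff hfix e).2 he
      have hve' : v ∉ σ '' e := fun h => (he' h).2 rfl
      rw [Set.image_insert_eq, hσv, insert_mem_edgeSet_coCone hv hve,
        insert_mem_edgeSet_coCone hv hve', σ.injective.encard_image, hσ e he]
      exact and_congr_left fun _ => iff_of_true (he.trans hSV) (he'.trans hSV)
    · have hapex : ∀ f ∈ E(G.coCone k v), v ∈ f := by
        rintro _ ⟨e, -, -, -, rfl⟩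
        exact Set.mem_insert v e
      refine iff_of_false (fun h => hvf (hapex _ h)) fun h => ?_
      obtain ⟨z, hz, hzv⟩ := hapex _ h
      exact hvf (σ.injective (hzv.trans hσv.symm) ▸ hz)
  · -- Here `S` has two elements, too few for an edge.
    refine isSymmetric_induce_of_twins hS hx hy hxy fun e he hsub => ?_
    have h2 : e.encard = (k + 1 : ℕ) := (hG.coCone hv).2 e he
    have h3 : e.encard ≤ 2 := by
      refine (Set.encard_le_encard hsub).trans ?_
      rw [hcard, ← one_add_one_eq_two]
      gcongr
      exact not_lt.1 hS1
    rw [h2] at h3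
    have : k + 1 ≤ 2 := by exact_mod_cast h3
    omega

/-- The condition needed for the next step: sets of old vertices are never edges of the cone. -/
theorem HasAvoidingNonedges.coCone {G : Hypergraph α} {k : ℕ} {v : α} (hv : v ∉ V(G))
    (hV : (k + 2 : ℕ) ≤ V(G).encard) : (G.coCone k v).HasAvoidingNonedges (k + 1) := by
  intro w
  have h : ((k + 1 : ℕ) : ℕ∞) ≤ (V(G) \ {w}).encard := by
    have := hV.trans (tsub_le_iff_right.1 (V(G).encard_tsub_one_le_encard_sdiff_singleton w))
    push_cast at this ⊢
    rw [← one_add_one_eq_two, ← add_assoc] at this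
    exact (ENat.add_le_add_iff_right (by simp)).1 this
  obtain ⟨e, he, hcard⟩ := Set.exists_subset_encard_eq h
  refine ⟨e, fun z hz => Or.inr (he hz).1, hcard, fun hw => (he hw).2 rfl, ?_⟩
  rintro ⟨e', -, -, -, rfl⟩
  exact hv (he (Set.mem_insert v e')).1

/-! ### A loose path with a chord -/

/-- The `i`-th edge of the loose path. -/
def pathEdge (i : ℕ) : Set ℕ := {2 * i, 2 * i + 1, 2 * i + 2}

/-- The `3`-graph formed by a loose path with `2 * c + 1` edges on the vertices
`0, …, 4 * c + 2` and one more edge, the chord, joining the two ends of the path to the vertex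
`2 * c`. -/
def theta (c : ℕ) : Hypergraph ℕ where
  vertexSet := {x | x ≤ 4 * c + 2}
  edgeSet := {e | (∃ i ≤ 2 * c, e = pathEdge i) ∨ e = {0, 2 * c, 4 * c + 2}}
  subset_vertexSet_of_mem_edgeSet' := by
    rintro _ (⟨i, hi, rfl⟩ | rfl) x hx <;>
      simp only [pathEdge, Set.mem_insert_iff, Set.mem_singleton_iff, Set.mem_ofPred_eq] at hx ⊢ <;>
      omega

theorem mem_pathEdge {i x : ℕ} : x ∈ pathEdge i ↔ x = 2 * i ∨ x = 2 * i + 1 ∨ x = 2 * i + 2 :=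
  Iff.rfl

theorem pathEdge_injective : Function.Injective pathEdge := by
  intro i j h
  have h1 : 2 * i + 1 ∈ pathEdge j := h ▸ mem_pathEdge.2 (by omega)
  rw [mem_pathEdge] at h1
  omega

theorem pathEdge_mem_theta {c i : ℕ} (hi : i ≤ 2 * c) : pathEdge i ∈ E(theta c) :=
  Or.inl ⟨i, hi, rfl⟩

theorem chord_mem_theta (c : ℕ) : ({0, 2 * c, 4 * c + 2} : Set ℕ) ∈ E(theta c) := Or.inr rfl

theorem pathEdge_ne_chord {c i : ℕ} : pathEdge i ≠ {0, 2 * c, 4 * c + 2} := by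
  intro h
  have h1 : 2 * i + 1 ∈ ({0, 2 * c, 4 * c + 2} : Set ℕ) := h ▸ mem_pathEdge.2 (by omega)
  simp only [Set.mem_insert_iff, Set.mem_singleton_iff] at h1
  omega

theorem encard_vertexSet_theta (c : ℕ) : V(theta c).encard = (4 * c + 3 : ℕ) := by
  have : V(theta c) = Finset.range (4 * c + 3) := by
    ext x
    simp only [Finset.coe_range, Set.mem_Iio]
    exact Nat.lt_succ_iff.symm
  rw [this, Set.encard_coe_eq_coe_finsetCard, Finset.card_range]

theorem isKGraph_theta {c : ℕ} (hc : 1 ≤ c) : (theta c).IsKGraph 3 := by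
  refine ⟨Set.finite_of_encard_eq_coe (encard_vertexSet_theta c), ?_⟩
  rintro _ (⟨i, hi, rfl⟩ | rfl)
  · exact Set.encard_eq_three.2 ⟨_, _, _, by omega, by omega, by omega, rfl⟩
  · exact Set.encard_eq_three.2 ⟨_, _, _, by omega, by omega, by omega, rfl⟩

theorem hasAvoidingNonedges_theta {c : ℕ} (hc : 2 ≤ c) : (theta c).HasAvoidingNonedges 3 := by
  -- Neither `{1, 3, 5}` nor `{0, 7, 9}` is an edge, and they are disjoint; `2 ≤ c` makes `9` a
  -- vertex.
  have key : ∀ a b d : ℕ, a < b → b < d → d ≤ 9 → b % 2 = 1 → d % 2 = 1 →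
      ({a, b, d} : Set ℕ) ⊆ V(theta c) ∧ ({a, b, d} : Set ℕ).encard = (3 : ℕ) ∧
        ({a, b, d} : Set ℕ) ∉ E(theta c) := by
    intro a b d hab hbd hd hb hd'
    refine ⟨?_, Set.encard_eq_three.2 ⟨_, _, _, by omega, by omega, by omega, rfl⟩, ?_⟩
    · intro x hx
      simp only [Set.mem_insert_iff, Set.mem_singleton_iff] at hx
      change x ≤ 4 * c + 2
      omega
    · rintro (⟨i, -, h⟩ | h)
      · have h1 : b ∈ pathEdge i := h ▸ by simp
        have h2 : d ∈ pathEdge i := h ▸ by simp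
        rw [mem_pathEdge] at h1 h2
        omega
      · have h1 : b ∈ ({0, 2 * c, 4 * c + 2} : Set ℕ) := h ▸ by simp
        simp only [Set.mem_insert_iff, Set.mem_singleton_iff] at h1
        omega
  intro w
  by_cases hw : w ∈ ({1, 3, 5} : Set ℕ)
  · obtain ⟨h1, h2, h3⟩ := key 0 7 9 (by omega) (by omega) (by omega) (by omega) (by omega)
    refine ⟨_, h1, h2, ?_, h3⟩
    simp only [Set.mem_insert_iff, Set.mem_singleton_iff] at hw ⊢
    omega
  · obtain ⟨h1, h2, h3⟩ := key 1 3 5 (by omega) (by omega) (by omega) (by omega) (by omega)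
    exact ⟨_, h1, h2, hw, h3⟩

/-- The odd vertices are singled out by an isomorphism-invariant property. -/
theorem odd_iff_mem_unique_edge {c x : ℕ} (hc : 1 ≤ c) (hx : x ≤ 4 * c + 2) :
    x % 2 = 1 ↔ ∀ e ∈ E(theta c), ∀ e' ∈ E(theta c), x ∈ e → x ∈ e' → e = e' := by
  constructor
  · have hchord : x % 2 = 1 → x ∉ ({0, 2 * c, 4 * c + 2} : Set ℕ) := by
      intro hodd h
      simp only [Set.mem_insert_iff, Set.mem_singleton_iff] at h
      omega
    rintro hodd _ (⟨i, hi, rfl⟩ | rfl) _ (⟨j, hj, rfl⟩ | rfl) h h'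
    · rw [mem_pathEdge] at h h'
      rw [show i = j by omega]
    · exact absurd h' (hchord hodd)
    · exact absurd h (hchord hodd)
    · rfl
  · intro h
    by_contra heven
    obtain ⟨i, rfl⟩ : ∃ i, x = 2 * i := ⟨x / 2, by omega⟩
    rcases Nat.eq_zero_or_pos i with rfl | hi
    · exact pathEdge_ne_chord (h _ (pathEdge_mem_theta (i := 0) (by omega)) _ (chord_mem_theta c)
        (mem_pathEdge.2 (by omega)) (by simp))
    rcases Nat.lt_or_ge (2 * c) i with hi' | hi'
    · refine pathEdge_ne_chord (h _ (pathEdge_mem_theta (i := 2 * c) (by omega)) _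
        (chord_mem_theta c) (mem_pathEdge.2 (by omega)) ?_)
      simp only [Set.mem_insert_iff, Set.mem_singleton_iff]
      omega
    · have := pathEdge_injective (h _ (pathEdge_mem_theta (i := i - 1) (by omega)) _
        (pathEdge_mem_theta hi') (mem_pathEdge.2 (by omega)) (mem_pathEdge.2 (by omega)))
      omega

theorem isAsymmetric_theta {c : ℕ} (hc : 1 ≤ c) : (theta c).IsAsymmetric := by
  rw [isAsymmetric_iff]
  intro σ hfix hσ
  have hV : ∀ x, σ x ≤ 4 * c + 2 ↔ x ≤ 4 * c + 2 := perm_apply_mem_iff hfix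
  have hodd : ∀ x ≤ 4 * c + 2, (σ x % 2 = 1 ↔ x % 2 = 1) := by
    intro x hx
    rw [odd_iff_mem_unique_edge hc hx, odd_iff_mem_unique_edge hc ((hV x).2 hx)]
    have himg : ∀ e, σ '' (σ.symm '' e) = e := σ.image_symm_image
    constructor
    · intro h e he e' he' hxe hxe'
      exact σ.injective.image_injective (h _ ((hσ e).1 he) _ ((hσ e').1 he')
        (Set.mem_image_of_mem σ hxe) (Set.mem_image_of_mem σ hxe'))
    · intro h e he e' he' hxe hxe'
      rw [← himg e, ← hσ] at he
      rw [← himg e', ← hσ] at he'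
      rw [← himg e, ← himg e', h _ he _ he' ⟨_, hxe, by simp⟩ ⟨_, hxe', by simp⟩]
  have hchord : σ '' {0, 2 * c, 4 * c + 2} = {0, 2 * c, 4 * c + 2} := by
    rcases (hσ _).1 (chord_mem_theta c) with ⟨i, hi, h⟩ | h
    · obtain ⟨y, hy, hyi⟩ : 2 * i + 1 ∈ σ '' {0, 2 * c, 4 * c + 2} :=
        h ▸ mem_pathEdge.2 (by omega)
      simp only [Set.mem_insert_iff, Set.mem_singleton_iff] at hy
      have := hodd y (by omega)
      omega
    · exact h
  have hpath : ∀ i ≤ 2 * c, ∃ j ≤ 2 * c, σ '' pathEdge i = pathEdge j := by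
    intro i hi
    rcases (hσ _).1 (pathEdge_mem_theta hi) with h | h
    · exact h
    · exact absurd (σ.injective.image_injective (h.trans hchord.symm)) pathEdge_ne_chord
  have hmem : ∀ x ∈ ({0, 2 * c, 4 * c + 2} : Set ℕ), σ x = 0 ∨ σ x = 2 * c ∨ σ x = 4 * c + 2 :=
    fun x hx => hchord.subset (Set.mem_image_of_mem σ hx)
  -- The vertex `2 * c` is the only one on the chord that lies on two edges of the path.
  have hcenter : σ (2 * c) = 2 * c := by
    obtain ⟨i, hi, h⟩ := hpath (c - 1) (by omega)
    obtain ⟨j, hj, h'⟩ := hpath c (by omega)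
    have h1 : σ (2 * c) ∈ pathEdge i := h ▸ ⟨_, mem_pathEdge.2 (by omega), rfl⟩
    have h2 : σ (2 * c) ∈ pathEdge j := h' ▸ ⟨_, mem_pathEdge.2 (by omega), rfl⟩
    have hij : i ≠ j := by
      rintro rfl
      have := pathEdge_injective (σ.injective.image_injective (h.trans h'.symm))
      omega
    rw [mem_pathEdge] at h1 h2
    have := hmem (2 * c) (by simp)
    omega
  have hstep : ∀ i ≤ 2 * c, ∃ j ≤ 2 * c, σ (2 * i + 1) = 2 * j + 1 ∧
      (σ (2 * i) = 2 * j ∧ σ (2 * i + 2) = 2 * j + 2 ∨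
        σ (2 * i) = 2 * j + 2 ∧ σ (2 * i + 2) = 2 * j) := by
    intro i hi
    obtain ⟨j, hj, h⟩ := hpath i hi
    have h0 : σ (2 * i) ∈ pathEdge j := h ▸ ⟨_, mem_pathEdge.2 (by omega), rfl⟩
    have h1 : σ (2 * i + 1) ∈ pathEdge j := h ▸ ⟨_, mem_pathEdge.2 (by omega), rfl⟩
    have h2 : σ (2 * i + 2) ∈ pathEdge j := h ▸ ⟨_, mem_pathEdge.2 (by omega), rfl⟩
    rw [mem_pathEdge] at h0 h1 h2
    have p0 := hodd (2 * i) (by omega)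
    have p1 := hodd (2 * i + 1) (by omega)
    have p2 := hodd (2 * i + 2) (by omega)
    have hne : σ (2 * i) ≠ σ (2 * i + 2) := fun h => by
      have := σ.injective h
      omega
    exact ⟨j, hj, by omega, by omega⟩
  have hinj : ∀ i, σ (2 * i + 1) ≠ σ (2 * i + 3) := fun i h => by
    have := σ.injective h
    omega
  have hends : σ 0 = 0 ∨ σ 0 = 4 * c + 2 := by
    have h0 := hmem 0 (by simp)
    have hne : σ 0 ≠ σ (2 * c) := fun h => by
      have := σ.injective h
      omega
    omega
  rcases hends with h0 | h0
  · have key : ∀ i ≤ 2 * c, σ (2 * i) = 2 * i ∧ σ (2 * i + 1) = 2 * i + 1 ∧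
        σ (2 * i + 2) = 2 * i + 2 := by
      intro i
      induction i with
      | zero =>
        intro hi
        obtain ⟨j, hj, h1, h2⟩ := hstep 0 hi
        simp only [mul_zero, zero_add] at h1 h2 ⊢
        omega
      | succ i ih =>
        intro hi
        obtain ⟨j, hj, h1, h2⟩ := hstep (i + 1) hi
        obtain ⟨i0, i1, i2⟩ := ih (by omega)
        have := hinj i
        simp only [mul_add, mul_one, add_assoc, Nat.reduceAdd] at *
        omega
    ext x
    rw [Equiv.Perm.one_apply]
    rcases Nat.lt_or_ge (4 * c + 2) x with hx | hx
    · exact hfix x (Nat.not_le.2 hx)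
    rcases Nat.lt_or_ge x (4 * c + 2) with hx' | hx'
    · obtain ⟨k0, k1, -⟩ := key (x / 2) (by omega)
      rcases Nat.mod_two_eq_zero_or_one x with hp | hp
      · rwa [show 2 * (x / 2) = x by omega] at k0
      · rwa [show 2 * (x / 2) + 1 = x by omega] at k1
    · have := (key (2 * c) le_rfl).2.2
      rwa [show 2 * (2 * c) + 2 = x by omega] at this
  · -- Otherwise `σ` reverses the path, whose midpoint is not `2 * c`.
    exfalso
    have key : ∀ i ≤ 2 * c, σ (2 * i) = 4 * c + 2 - 2 * i ∧ σ (2 * i + 1) = 4 * c + 1 - 2 * i ∧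
        σ (2 * i + 2) = 4 * c - 2 * i := by
      intro i
      induction i with
      | zero =>
        intro hi
        obtain ⟨j, hj, h1, h2⟩ := hstep 0 hi
        simp only [mul_zero, zero_add] at h1 h2 ⊢
        omega
      | succ i ih =>
        intro hi
        obtain ⟨j, hj, h1, h2⟩ := hstep (i + 1) hi
        obtain ⟨i0, i1, i2⟩ := ih (by omega)
        have := hinj i
        simp only [mul_add, mul_one, add_assoc, Nat.reduceAdd] at *
        omega
    have := (key c (by omega)).1
    omega

/-! ### Symmetry of the proper induced subhypergraphs -/

/-- If the only edges of `theta c` inside `S` are the chord and the path edges between two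
neighbouring vertices `2 * a`, `2 * b` of the chord along the path, then they form a cycle through
the chord, which can be reflected. -/
theorem isSymmetric_induce_theta_of_cycle {c a b : ℕ} {S : Set ℕ} (hS : S ⊆ V(theta c))
    (hab : a < b) (hseg : ∀ x, 2 * a ≤ x → x ≤ 2 * b → x ∈ S)
    (hends : (a = 0 ∧ b = c) ∨ (a = c ∧ b = 2 * c + 1))
    (hS' : ∀ i ≤ 2 * c, pathEdge i ⊆ S → a ≤ i ∧ i < b) :
    ((theta c).induce S).IsSymmetric := by
  refine isSymmetric_induce_of_involutive hS
    (ρ := fun x => if 2 * a ≤ x ∧ x ≤ 2 * b then 2 * a + 2 * b - x else x) ?_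
    ⟨2 * a, ?_⟩ ?_ ?_
  · intro x
    dsimp only
    split_ifs <;> omega
  · split_ifs <;> omega
  · intro x hx
    rw [if_neg fun h => hx (hseg x h.1 h.2)]
  · rintro _ hsub (⟨i, hi, rfl⟩ | rfl)
    · obtain ⟨hai, hib⟩ := hS' i hi hsub
      have : pathEdge (a + b - 1 - i) ∈ E(theta c) := pathEdge_mem_theta (by omega)
      convert this using 1
      rw [pathEdge, Set.image_insert_eq, Set.image_pair]
      ext x
      rw [mem_pathEdge]
      simp only [Set.mem_insert_iff, Set.mem_singleton_iff]
      split_ifs <;> omega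
    · convert chord_mem_theta c using 1
      rw [Set.image_insert_eq, Set.image_pair]
      ext x
      simp only [Set.mem_insert_iff, Set.mem_singleton_iff]
      split_ifs <;> omega

theorem isSymmetric_induce_theta {c : ℕ} (hc : 1 ≤ c) {S : Set ℕ} (hS : S ⊆ V(theta c))
    (h1 : 1 < S.encard) (hne : S ≠ V(theta c)) : ((theta c).induce S).IsSymmetric := by
  by_cases hchord : ({0, 2 * c, 4 * c + 2} : Set ℕ) ⊆ S
  swap
  · -- Without the chord, the last path edge in `S` has two vertices lying on no other edge.
    by_cases hex : ∃ i ≤ 2 * c, pathEdge i ⊆ S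
    · classical
      obtain ⟨i, ⟨hi, hiS⟩, hmax⟩ : ∃ i, (i ≤ 2 * c ∧ pathEdge i ⊆ S) ∧
          ∀ j, j ≤ 2 * c ∧ pathEdge j ⊆ S → j ≤ i := by
        obtain ⟨j, hj⟩ := hex
        exact ⟨_, Nat.findGreatest_spec (P := fun i => i ≤ 2 * c ∧ pathEdge i ⊆ S) hj.1 hj,
          fun j hj => Nat.le_findGreatest hj.1 hj⟩
      refine isSymmetric_induce_of_twins hS (hiS (mem_pathEdge.2 (Or.inr (Or.inl rfl))))
        (hiS (mem_pathEdge.2 (Or.inr (Or.inr rfl)))) (by omega) ?_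
      rintro _ (⟨j, hj, rfl⟩ | rfl) hsub
      · have := hmax j ⟨hj, hsub⟩
        rw [mem_pathEdge, mem_pathEdge]
        omega
      · exact absurd hsub hchord
    · obtain ⟨x, y, hx, hy, hxy⟩ := Set.one_lt_encard_iff.1 h1
      refine isSymmetric_induce_of_twins hS hx hy hxy ?_
      rintro _ (⟨j, hj, rfl⟩ | rfl) hsub
      · exact absurd ⟨j, hj, hsub⟩ hex
      · exact absurd hsub hchord
  -- A run of path edges in `S` ending away from the chord ends in a pair of twins.
  by_cases hrun : ∃ i < 2 * c, i + 1 ≠ c ∧ ¬(pathEdge i ⊆ S ↔ pathEdge (i + 1) ⊆ S)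
  · obtain ⟨i, hi, hic, hdiff⟩ := hrun
    by_cases hiS : pathEdge i ⊆ S
    · have hiS' : ¬pathEdge (i + 1) ⊆ S := by tauto
      refine isSymmetric_induce_of_twins hS (hiS (mem_pathEdge.2 (Or.inr (Or.inl rfl))))
        (hiS (mem_pathEdge.2 (Or.inr (Or.inr rfl)))) (by omega) ?_
      rintro _ (⟨j, hj, rfl⟩ | rfl) hsub
      · have : j ≠ i + 1 := by
          rintro rfl
          exact hiS' hsub
        rw [mem_pathEdge, mem_pathEdge]
        omega
      · simp only [Set.mem_insert_iff, Set.mem_singleton_iff]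
        omega
    · have hiS' : pathEdge (i + 1) ⊆ S := by tauto
      refine isSymmetric_induce_of_twins hS (hiS' (mem_pathEdge.2 (Or.inl rfl)))
        (hiS' (mem_pathEdge.2 (Or.inr (Or.inl rfl)))) (by omega) ?_
      rintro _ (⟨j, hj, rfl⟩ | rfl) hsub
      · have : j ≠ i := by
          rintro rfl
          exact hiS hsub
        rw [mem_pathEdge, mem_pathEdge]
        omega
      · simp only [Set.mem_insert_iff, Set.mem_singleton_iff]
        omega
  -- So each of the two segments of the path is either contained in `S` or has no edge in `S`.
  push Not at hrun
  have hleft : ∀ i < c, pathEdge i ⊆ S ↔ pathEdge 0 ⊆ S := by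
    intro i
    induction i with
    | zero => exact fun _ => Iff.rfl
    | succ i ih => exact fun hi => (hrun i (by omega) (by omega)).symm.trans (ih (by omega))
  have hright : ∀ i, c + i ≤ 2 * c → (pathEdge (c + i) ⊆ S ↔ pathEdge c ⊆ S) := by
    intro i
    induction i with
    | zero => exact fun _ => Iff.rfl
    | succ i ih =>
      exact fun hi => (hrun (c + i) (by omega) (by omega)).symm.trans (ih (by omega))
  have hright' : ∀ i, c ≤ i → i ≤ 2 * c → (pathEdge i ⊆ S ↔ pathEdge c ⊆ S) := by
    intro i h h'
    obtain ⟨d, rfl⟩ := Nat.exists_eq_add_of_le h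
    exact hright d h'
  have hsegment : ∀ a b, (∀ i, a ≤ i → i < b → pathEdge i ⊆ S) → a < b →
      ∀ x, 2 * a ≤ x → x ≤ 2 * b → x ∈ S := by
    intro a b h hab x hx hx'
    rcases Nat.lt_or_ge x (2 * b) with hlt | hge
    · exact h (x / 2) (by omega) (by omega) (mem_pathEdge.2 (by omega))
    · exact h (b - 1) (by omega) (by omega) (mem_pathEdge.2 (by omega))
  by_cases hl : pathEdge 0 ⊆ S <;> by_cases hr : pathEdge c ⊆ S
  · refine absurd (hS.antisymm fun x hx => ?_) hne
    refine hsegment 0 (2 * c + 1) (fun i _ hi => ?_) (by omega) x (by omega) ?_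
    · rcases Nat.lt_or_ge i c with h | h
      · exact (hleft i h).2 hl
      · exact (hright' i h (by omega)).2 hr
    · have : x ≤ 4 * c + 2 := hx
      omega
  · refine isSymmetric_induce_theta_of_cycle hS (a := 0) (b := c) (by omega)
      (hsegment 0 c (fun i _ hi => (hleft i hi).2 hl) (by omega)) (by omega) fun i hi hiS => ?_
    refine ⟨Nat.zero_le i, ?_⟩
    by_contra hic
    exact hr ((hright' i (by omega) hi).1 hiS)
  · refine isSymmetric_induce_theta_of_cycle hS (a := c) (b := 2 * c + 1) (by omega)
      (hsegment c _ (fun i h hi => (hright' i h (by omega)).2 hr) (by omega)) (by omega)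
      fun i hi hiS => ⟨?_, by omega⟩
    by_contra hic
    exact hl ((hleft i (by omega)).1 hiS)
  · -- The chord is the only edge left.
    refine isSymmetric_induce_of_twins hS (x := 0) (y := 4 * c + 2) (hchord (by simp))
      (hchord (by simp)) (by omega) ?_
    rintro _ (⟨j, hj, rfl⟩ | rfl) hsub
    · rcases Nat.lt_or_ge j c with h | h
      · exact absurd ((hleft j h).1 hsub) hl
      · exact absurd ((hright' j h hj).1 hsub) hr
    · simp

theorem isMinimalAsymmetric_theta {c : ℕ} (hc : 1 ≤ c) : (theta c).IsMinimalAsymmetric := by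
  refine ⟨isAsymmetric_theta hc, fun S hS h1 hlt => isSymmetric_induce_theta hc hS h1 ?_⟩
  rintro rfl
  exact lt_irrefl _ hlt

/-! ### Infinitely many minimal asymmetric hypergraphs -/

theorem exists_isMinimalAsymmetric_encard {c k : ℕ} (hc : 2 ≤ c) (hk : 3 ≤ k) :
    ∃ G : Hypergraph ℕ, G.IsKGraph k ∧ G.IsMinimalAsymmetric ∧ G.HasAvoidingNonedges k ∧
      V(G).encard = (4 * c + k : ℕ) := by
  induction k, hk using Nat.le_induction with
  | base =>
    exact ⟨theta c, isKGraph_theta (by omega), isMinimalAsymmetric_theta (by omega),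
      hasAvoidingNonedges_theta hc, encard_vertexSet_theta c⟩
  | succ k hk ih =>
    obtain ⟨G, hG, hmin, hN, hcard⟩ := ih
    obtain ⟨v, hv⟩ := hG.1.exists_notMem
    refine ⟨G.coCone k v, hG.coCone hv, hmin.coCone (by omega) hG hN hv,
      HasAvoidingNonedges.coCone hv ?_, ?_⟩
    · rw [hcard]
      exact_mod_cast (by omega : k + 2 ≤ 4 * c + k)
    · change (insert v V(G)).encard = _
      rw [Set.encard_insert_of_notMem hv, hcard]
      rfl

end Hypergraph

/-- For every `k ≥ 3` there are infinitely many, pairwise non-isomorphic, minimal asymmetric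
`k`-graphs. -/
theorem theorem3 (k : ℕ) (hk : 3 ≤ k) :
    ∃ G : ℕ → Hypergraph ℕ,
      (∀ n, (G n).IsKGraph k ∧ (G n).IsMinimalAsymmetric) ∧
      ∀ m n, m ≠ n → ¬ (G m).Isomorphic (G n) := by
  choose G hG hmin _ hcard using fun n : ℕ =>
    Hypergraph.exists_isMinimalAsymmetric_encard (c := n + 2) (by omega) hk
  refine ⟨G, fun n => ⟨hG n, hmin n⟩, fun m n hmn hiso => hmn ?_⟩
  have h := hiso.encard_eq
  rw [hcard, hcard, Nat.cast_inj] at h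
  omega
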